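/- Let $q$ be an indeterminate, and for $m\ge 0$ let $[m]_{p,q}=p^{m-1}+p^{m-2}q+\cdots+pq^{m-2}+q^{m-1}$ (so $[0]_{p,q}=0$) and $[m]_q=[m]_{1,q}=1+q+\cdots+q^{m-1}$. For $k\ge 0$ and $n\ge 1$ let Williams' $q$-Eulerian number be the Laurent polynomial $$ \hat{E}_{k,n}(q)=q^{k-k^2}\sum_{i=0}^{k-1}(-1)^i\,[k-i]_q^{\,n}\,q^{k(i-1)}\left(\binom{n}{i}q^{k-i}+\binom{n}{i-1}\right)\in\mathbb{Z}[q,q^{-1}], $$ where $\binom{n}{-1}=0$, and put $$ \hat{E}(q,x,y)=1+\sum_{n\ge 1}\sum_{k\ge 0}\hat{E}_{k,n}(q)\,y^kx^n , $$ the term $1$ being that of $n=k=0$ (the empty permutation). Let $F(q,p,x,y)$ be the formal power series in $x$ defined by the continued fraction $$ F(q,p,x,y)=\cfrac{1}{1-b_0x-\cfrac{\lambda_1x^2}{1-b_1x-\cfrac{\lambda_2x^2}{1-b_2x-\cfrac{\lambda_3x^2}{\ddots}}}},\qquad b_n=y[n+1]_{p,q}+[n]_{p,q},\quad \lambda_n=y[n]_{p,q}^2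 , $$ that is, the coefficientwise limit of its convergents. Theorem. As formal power series in $x$ and $y$ over $\mathbb{Z}[q,q^{-1}]$, $$ \hat{E}(q,x,y)=F(q,1,x,y). $$ -/

import Mathlib

open Finset
open scoped PowerSeries LaurentPolynomial

noncomputable section

namespace QEulerian

/-- The `N`-th convergent of the formal continued fraction
`1 / (1 - b₀ x - lam₁ x² / (1 - b₁ x - lam₂ x² / (1 - b₂ x - ...)))` in `R⟦x⟧`: only the first `N`
denominators are kept, the remaining tail being replaced by `0`. Each denominator has
constant coefficient `1`, hence is invertible, and `PowerSeries.invOfUnit _ 1` is its inverse. -/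
def jConvergent {R : Type*} [CommRing R] (b lam : ℕ → R) : ℕ → R⟦X⟧
  | 0 => 0
  | N + 1 =>
      PowerSeries.invOfUnit
        (1 - PowerSeries.C (b 0) * PowerSeries.X
          - PowerSeries.C (lam 1) * PowerSeries.X ^ 2
              * jConvergent (fun n => b (n + 1)) (fun n => lam (n + 1)) N) 1

/-- The infinite continued fraction
`1 / (1 - b₀ x - lam₁ x² / (1 - b₁ x - lam₂ x² / (1 - b₂ x - ...)))` as a formal power series
in `x`, i.e. the coefficientwise limit of its convergents: the coefficient of `x ^ n` is the same
in all convergents of index greater than `n` (see `coeff_jConvergent`). -/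
def jFraction {R : Type*} [CommRing R] (b lam : ℕ → R) : R⟦X⟧ :=
  PowerSeries.mk fun n => PowerSeries.coeff n (jConvergent b lam (n + 1))

theorem jConvergent_succ_mul {R : Type*} [CommRing R] (b lam : ℕ → R) (N : ℕ) :
    (1 - PowerSeries.C (b 0) * PowerSeries.X
      - PowerSeries.C (lam 1) * PowerSeries.X ^ 2
          * jConvergent (fun n => b (n + 1)) (fun n => lam (n + 1)) N)
      * jConvergent b lam (N + 1) = 1 := by
  rw [jConvergent]
  apply PowerSeries.mul_invOfUnit
  simp

theorem X_pow_dvd_jConvergent_sub {R : Type*} [CommRing R] (N : ℕ) :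
    ∀ (b lam : ℕ → R) (M : ℕ), N ≤ M →
      (PowerSeries.X : R⟦X⟧) ^ N ∣ jConvergent b lam M - jConvergent b lam N := by
  induction N with
  | zero => intro b lam M _; simp
  | succ N ih =>
    intro b lam M hM
    obtain ⟨M, rfl⟩ : ∃ M', M = M' + 1 := ⟨M - 1, by omega⟩
    obtain ⟨c, hc⟩ := ih (fun n => b (n + 1)) (fun n => lam (n + 1)) M (by omega)
    have h1 := jConvergent_succ_mul b lam M
    have h2 := jConvergent_succ_mul b lam N
    refine ⟨jConvergent b lam (M + 1) * jConvergent b lam (N + 1)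
      * PowerSeries.C (lam 1) * PowerSeries.X * c, ?_⟩
    linear_combination jConvergent b lam (N + 1) * h1 - jConvergent b lam (M + 1) * h2
      + jConvergent b lam (M + 1) * jConvergent b lam (N + 1)
        * PowerSeries.C (lam 1) * PowerSeries.X ^ 2 * hc

/-- The convergents stabilize coefficientwise to the continued fraction. -/
theorem coeff_jConvergent {R : Type*} [CommRing R] (b lam : ℕ → R) {n N : ℕ} (h : n < N) :
    PowerSeries.coeff n (jConvergent b lam N) = PowerSeries.coeff n (jFraction b lam) := by
  have := PowerSeries.X_pow_dvd_iff.mp (X_pow_dvd_jConvergent_sub (n + 1) b lam N h) n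
    (Nat.lt_succ_self n)
  rw [map_sub, sub_eq_zero] at this
  rw [this, jFraction, PowerSeries.coeff_mk]

/-- `[n]_{p,q} = p^(n-1) + p^(n-2) q + ⋯ + p q^(n-2) + q^(n-1)`. -/
def pqNumber {R : Type*} [CommRing R] (p q : R) (n : ℕ) : R :=
  ∑ i ∈ range n, p ^ (n - 1 - i) * q ^ i

/-- `F(q,p,x,y)`: the continued fraction with `b_n = y [n+1]_{p,q} + [n]_{p,q}` and
`lam_n = y [n]_{p,q}^2`, as a power series in `x` over a ring that contains `q`, `p` and `y`. -/
def F {R : Type*} [CommRing R] (q p y : R) : R⟦X⟧ :=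
  jFraction (fun n => y * pqNumber p q (n + 1) + pqNumber p q n)
    (fun n => y * pqNumber p q n ^ 2)

/-- `[n]_q = 1 + q + ⋯ + q^(n-1)`, as a Laurent polynomial in `q`. -/
def qNumber (n : ℕ) : ℤ[T;T⁻¹] :=
  ∑ i ∈ range n, LaurentPolynomial.T (i : ℤ)

/-- Williams' `q`-Eulerian number
`Ê_{k,n}(q) = q^(k-k²) ∑_{i=0}^{k-1} (-1)^i [k-i]_q^n q^(k(i-1)) (C(n,i) q^(k-i) + C(n,i-1))`,
where `C(n,-1) = 0`, as a Laurent polynomial in `q`. -/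
def qEulerian (k n : ℕ) : ℤ[T;T⁻¹] :=
  LaurentPolynomial.T ((k : ℤ) - (k : ℤ) ^ 2) *
    ∑ i ∈ range k,
      (-1) ^ i * qNumber (k - i) ^ n * LaurentPolynomial.T ((k : ℤ) * ((i : ℤ) - 1)) *
        ((n.choose i : ℤ[T;T⁻¹]) * LaurentPolynomial.T ((k : ℤ) - (i : ℤ))
          + (if i = 0 then 0 else (n.choose (i - 1) : ℤ[T;T⁻¹])))

/-- `Ê(q,x,y) = ∑_{n,k} Ê_{k,n}(q) y^k x^n`, as a power series in `x` whose coefficients are power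
series in `y` over the Laurent polynomials in `q`. For `n = 0` the only term is the constant `1`
(the empty permutation), and for `n ≥ 1` every `k ≥ 0` is included. -/
def qEulerianSeries : ℤ[T;T⁻¹]⟦X⟧⟦X⟧ :=
  PowerSeries.mk fun n => if n = 0 then 1 else PowerSeries.mk fun k => qEulerian k n

end QEulerian

end

/-! Both sides are the moment series of one linear functional `L` on polynomials in `t`. With `p =
q⁻¹`, `L` is the `y`-adically convergent sum over nodes `t_j = [j]_q (1 - y p^j)` with weights `y^j
p^(j²) (q^j - y p^j)`. Expanding `∑_j weight_j t_j^n` in powers of `y` gives Williams' formula, the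
index `i` there being `k - j` (`qEulerian_eq_sum`). For the fraction, let `N_k` be the Newton
polynomials at the nodes, scaled so that `t N_k = [k+1] N_{k+1} + t_k N_k`. Telescoping gives
`L(N_k) = y^k p^(k choose 2)`. The polynomials `P_n = ∑_k opCoeff n k • N_k` satisfy `t P_n = [n+1]
P_{n+1} + b_n P_n + y [n] P_{n-1}` (`opCoeff_recurrence`) and `L(P_n) = 0` for `n ≥ 1`. So the
moments `L(t^m)` are corner entries of powers of a tridiagonal matrix, hence the coefficients of the
fraction with `λ_n = [n] · y [n]` (`mk_eq_jFraction`). -/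

namespace QEulerian

/-! ### Tridiagonal recurrences and continued fractions -/

section ContinuedFraction

variable {R : Type*} [CommRing R]

/-- A chain of three-term relations determines its first member up to the convergents. -/
theorem X_pow_dvd_sub_jConvergent_mul (N : ℕ) :
    ∀ (b α β : ℕ → R) (B : ℕ → R⟦X⟧) (c : R⟦X⟧),
      (1 - PowerSeries.C (b 0) * PowerSeries.X) * B 0
        = c + PowerSeries.C (α 1) * PowerSeries.X ^ 2 * B 1 →
      (∀ n, (1 - PowerSeries.C (b (n + 1)) * PowerSeries.X) * B (n + 1)
        = PowerSeries.C (β (n + 1)) * B n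
          + PowerSeries.C (α (n + 2)) * PowerSeries.X ^ 2 * B (n + 2)) →
      (PowerSeries.X : R⟦X⟧) ^ N ∣ B 0 - jConvergent b (fun n => α n * β n) N * c := by
  induction N with
  | zero => intros; simp
  | succ N ih =>
    intro b α β B c h0 h
    -- The tail `B 1, B 2, …` is a chain of the same shape, with `β 1 * B 0` as its inhomogeneous
    -- term.
    obtain ⟨d, hd⟩ := ih (fun n => b (n + 1)) (fun n => α (n + 1)) (fun n => β (n + 1))
      (fun n => B (n + 1)) (PowerSeries.C (β 1) * B 0) (h 0) (fun n => h (n + 1))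
    have h1 := jConvergent_succ_mul b (fun n => α n * β n) N
    simp only [map_mul] at h1
    simp only [zero_add] at hd
    refine ⟨jConvergent b (fun n => α n * β n) (N + 1) * PowerSeries.C (α 1) * PowerSeries.X * d, ?_⟩
    linear_combination -(B 0) * h1 + jConvergent b (fun n => α n * β n) (N + 1) * h0
      + jConvergent b (fun n => α n * β n) (N + 1) * PowerSeries.C (α 1) * PowerSeries.X ^ 2 * hd

/-- Powers of a tridiagonal matrix applied to the first basis vector have the coefficients of
a continued fraction as their first entries. -/
theorem mk_eq_jFraction (b α β : ℕ → R) (a : ℕ → ℕ → R) (h00 : a 0 0 = 1)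
    (h0 : ∀ n, a 0 (n + 1) = 0)
    (hz : ∀ m, a (m + 1) 0 = α 1 * a m 1 + b 0 * a m 0)
    (hs : ∀ m n, a (m + 1) (n + 1)
      = α (n + 2) * a m (n + 2) + b (n + 1) * a m (n + 1) + β (n + 1) * a m n) :
    PowerSeries.mk (fun m => a m 0) = jFraction b (fun n => α n * β n) := by
  have hv : ∀ m n, m < n → a m n = 0 := by
    intro m
    induction m with
    | zero =>
      intro n hn
      obtain ⟨n, rfl⟩ := Nat.exists_eq_succ_of_ne_zero hn.ne'
      exact h0 n
    | succ m ih =>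
      intro n hn
      obtain ⟨n, rfl⟩ := Nat.exists_eq_succ_of_ne_zero (Nat.ne_zero_of_lt hn)
      rw [Nat.succ_eq_add_one, hs, ih _ (by omega), ih _ (by omega), ih _ (by omega)]
      simp
  -- By `hv` the `n`-th column series is divisible by `X ^ n`. Dividing this power out turns the
  -- matrix recurrence into the chain, with `X ^ 2` on the upper term only.
  have key := fun N => X_pow_dvd_sub_jConvergent_mul N b α β
    (fun n => PowerSeries.mk fun m => a (m + n) n) 1 ?_ ?_
  · ext n
    rw [← coeff_jConvergent b _ (Nat.lt_succ_self n)]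
    have := PowerSeries.X_pow_dvd_iff.mp (key (n + 1)) n (Nat.lt_succ_self n)
    rw [map_sub, sub_eq_zero, mul_one] at this
    simpa using this
  · ext m
    rcases m with _ | _ | m
    · simp [sub_mul, mul_assoc, h00, pow_two]
    · simp [sub_mul, mul_assoc, pow_two, PowerSeries.coeff_one, hz,
        PowerSeries.coeff_succ_X_mul, hv 0 1]
    · simp [sub_mul, mul_assoc, pow_two, PowerSeries.coeff_one, hz (m + 1),
        PowerSeries.coeff_succ_X_mul]
  · intro n
    ext m
    rcases m with _ | _ | m
    · simp [sub_mul, mul_assoc, pow_two, hs n n, hv n (n + 1), hv n (n + 2)]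
    · have := hs (n + 1) n
      simp [sub_mul, mul_assoc, pow_two, PowerSeries.coeff_succ_X_mul, add_comm, add_left_comm,
        hv (n + 1) (n + 2)] at this ⊢
      linear_combination this
    · have := hs (m + n + 2) n
      simp [sub_mul, mul_assoc, pow_two, PowerSeries.coeff_succ_X_mul]
      rw [show m + 1 + 1 + (n + 1) = m + n + 2 + 1 by ring, show m + 1 + (n + 1) = m + n + 2 by ring,
        show m + 1 + 1 + n = m + n + 2 by ring, show m + (n + 2) = m + n + 2 by ring]
      linear_combination this

end ContinuedFraction

/-! ### Gaussian binomials and the coefficients of the orthogonal polynomials -/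

section Gauss

variable {R : Type*} [CommRing R]

theorem pqNumber_one_mul (q : R) (n : ℕ) : pqNumber 1 q n * (1 - q) = 1 - q ^ n := by
  simp only [pqNumber, one_pow, one_mul]
  linear_combination -geom_sum_mul q n

/-- The Gaussian binomial coefficients. -/
def gauss (q : R) : ℕ → ℕ → R
  | _, 0 => 1
  | 0, _ + 1 => 0
  | n + 1, k + 1 => gauss q n k + q ^ (k + 1) * gauss q n (k + 1)

theorem gauss_zero_right (q : R) (n : ℕ) : gauss q n 0 = 1 := by cases n <;> rfl

/-- The ratio of neighbouring Gaussian binomials, cleared of denominators; `opCoeff_step` is its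
analogue in base `p`. -/
theorem gauss_step (q : R) (n : ℕ) : ∀ k,
    q ^ k * (1 - q ^ (k + 1)) * gauss q n (k + 1) = (q ^ k - q ^ n) * gauss q n k := by
  induction n with
  | zero =>
    rintro (_ | k) <;> simp [gauss]
  | succ n ih =>
    rintro (_ | k)
    · have := ih 0
      simp only [gauss, gauss_zero_right] at this ⊢
      linear_combination q * this
    · have h1 := ih k
      have h2 := ih (k + 1)
      simp only [gauss]
      linear_combination q * h1 + q ^ (k + 2) * h2

/-- The coefficients of the orthogonal polynomials: `(-y)^(n-k)` times a Gaussian binomial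
coefficient. -/
def opCoeff (p y : R) : ℕ → ℕ → R
  | 0, 0 => 1
  | 0, _ + 1 => 0
  | n + 1, 0 => -y * opCoeff p y n 0
  | n + 1, k + 1 => opCoeff p y n k - y * p ^ (k + 1) * opCoeff p y n (k + 1)

theorem opCoeff_eq_zero (p y : R) (n : ℕ) : ∀ k, n < k → opCoeff p y n k = 0 := by
  induction n with
  | zero =>
    rintro (_ | k) h
    · omega
    · rfl
  | succ n ih =>
    rintro (_ | k) h
    · omega
    · simp [opCoeff, ih k (by omega), ih (k + 1) (by omega)]

theorem opCoeff_step (p y : R) (n : ℕ) : ∀ k,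
    (p ^ k - p ^ n) * opCoeff p y n k = -y * (1 - p ^ (k + 1)) * p ^ k * opCoeff p y n (k + 1) := by
  induction n with
  | zero => rintro (_ | k) <;> simp [opCoeff]
  | succ n ih =>
    rintro (_ | k)
    · have := ih 0
      simp only [opCoeff] at this ⊢
      linear_combination -y * p * this
    · have h1 := ih k
      have h2 := ih (k + 1)
      simp only [opCoeff]
      linear_combination p * h1 - y * p ^ (k + 2) * h2

theorem opCoeff_recurrence_zero (q p y : R) (n : ℕ) :
    0 = pqNumber 1 q (n + 2) * opCoeff p y (n + 2) 0
      + (y * pqNumber 1 q (n + 2) + pqNumber 1 q (n + 1)) * opCoeff p y (n + 1) 0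
      + y * pqNumber 1 q (n + 1) * opCoeff p y n 0 := by
  simp only [opCoeff]
  ring

variable [IsDomain R] {q p : R}

/-- The three-term recurrence of the orthogonal polynomials, read off coefficientwise. -/
theorem opCoeff_recurrence (hqp : q * p = 1) (hq : q ≠ 1) (y : R) (n k : ℕ) :
    pqNumber 1 q (k + 1) * opCoeff p y (n + 1) k
        + pqNumber 1 q (k + 1) * (1 - y * p ^ (k + 1)) * opCoeff p y (n + 1) (k + 1)
      = pqNumber 1 q (n + 2) * opCoeff p y (n + 2) (k + 1)
        + (y * pqNumber 1 q (n + 2) + pqNumber 1 q (n + 1)) * opCoeff p y (n + 1) (k + 1)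
        + y * pqNumber 1 q (n + 1) * opCoeff p y n (k + 1) := by
  have hq' : (1 - q) ≠ 0 := sub_ne_zero.mpr hq.symm
  -- Multiplying by `1 - q` turns each `[m]_q` into `1 - q ^ m`.
  apply mul_right_cancel₀ hq'
  have e1 := pqNumber_one_mul q (k + 1)
  have e2 := pqNumber_one_mul q (n + 1)
  have e3 := pqNumber_one_mul q (n + 2)
  have hn : q ^ n * p ^ n = 1 := by rw [← mul_pow, hqp, one_pow]
  have hk : q ^ k * p ^ k = 1 := by rw [← mul_pow, hqp, one_pow]
  have s1 := opCoeff_step p y n k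
  have s2 := opCoeff_step p y (n + 1) k
  have hC : opCoeff p y (n + 1) (k + 1)
    = opCoeff p y n k - y * p ^ (k + 1) * opCoeff p y n (k + 1) := rfl
  have hC2 : opCoeff p y (n + 2) (k + 1)
    = opCoeff p y (n + 1) k - y * p ^ (k + 1) * opCoeff p y (n + 1) (k + 1) := rfl
  -- `t1` and `t2` compare neighbouring coefficients along `n` and along `k`; a power of `q` clears
  -- the powers of `p = q⁻¹` in `opCoeff_step`.
  have t1 : (q ^ (n + 1) - q ^ (k + 1)) * opCoeff p y (n + 1) (k + 1)
      = (1 - q ^ (n + 1)) * (y * opCoeff p y n (k + 1)) := by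
    have : q ^ (n + 1 + k) * ((p ^ k - p ^ n) * opCoeff p y (n + 1) (k + 1))
        = q ^ (n + 1 + k) * (-y * p ^ k * (1 - p ^ (n + 1)) * opCoeff p y n (k + 1)) := by
      rw [hC]; linear_combination q ^ (n + 1 + k) * s1
    have x1 : q ^ (n + 1 + k) * (p ^ k - p ^ n) = q ^ (n + 1) - q ^ (k + 1) := by
      linear_combination q ^ (n + 1) * hk - q ^ (k + 1) * hn
    have x2 : q ^ (n + 1 + k) * (p ^ k * (1 - p ^ (n + 1))) = q ^ (n + 1) - 1 := by
      linear_combination q ^ (n + 1) * (1 - p ^ (n + 1)) * hk - q * p * hn - hqp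
    linear_combination this - opCoeff p y (n + 1) (k + 1) * x1 - y * opCoeff p y n (k + 1) * x2
  have t2 : (q ^ (n + 2) - q ^ (k + 1)) * opCoeff p y (n + 1) k
      = -y * (1 - p ^ (k + 1)) * q ^ (n + 2) * opCoeff p y (n + 1) (k + 1) := by
    have x1 : q ^ (n + 2 + k) * (p ^ k - p ^ (n + 1)) = q ^ (n + 2) - q ^ (k + 1) := by
      linear_combination q ^ (n + 2) * hk - q ^ (k + 1) * (q * p) * hn - q ^ (k + 1) * hqp
    linear_combination q ^ (n + 2 + k) * s2 - opCoeff p y (n + 1) k * x1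
      - y * (1 - p ^ (k + 1)) * q ^ (n + 2) * opCoeff p y (n + 1) (k + 1) * hk
  have hk1 : q ^ (k + 1) * p ^ (k + 1) = 1 := by rw [← mul_pow, hqp, one_pow]
  rw [hC2]
  linear_combination (opCoeff p y (n + 1) k
      + (1 - y * p ^ (k + 1)) * opCoeff p y (n + 1) (k + 1)) * e1
    - (opCoeff p y (n + 1) k - y * p ^ (k + 1) * opCoeff p y (n + 1) (k + 1)
      + y * opCoeff p y (n + 1) (k + 1)) * e3
    - (opCoeff p y (n + 1) (k + 1) + y * opCoeff p y n (k + 1)) * e2 + t1 + t2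
    + y * opCoeff p y (n + 1) (k + 1) * hk1

end Gauss

end QEulerian

namespace QEulerian

/-! ### The functional on the Newton basis and on the orthogonal polynomials -/

section Measure

variable {R : Type*} [CommRing R]

/-- The moments of the orthogonality functional against the basis adapted to the nodes
`[k]_q (1 - y p^k)`. -/
def mixedMoment (q p y : R) : ℕ → ℕ → R
  | 0, k => y ^ k * p ^ (k.choose 2)
  | m + 1, k => pqNumber 1 q (k + 1) * mixedMoment q p y m (k + 1)
      + pqNumber 1 q k * (1 - y * p ^ k) * mixedMoment q p y m k

/-- The moments of the orthogonality functional against the orthogonal polynomials. -/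
def opMoment (q p y : R) (m n : ℕ) : R :=
  ∑ k ∈ range (n + 1), opCoeff p y n k * mixedMoment q p y m k

theorem opMoment_eq_sum_range (q p y : R) (m : ℕ) {n N : ℕ} (h : n < N) :
    opMoment q p y m n = ∑ k ∈ range N, opCoeff p y n k * mixedMoment q p y m k := by
  apply sum_subset (range_mono h)
  intro k _ hk
  rw [opCoeff_eq_zero p y n k (by simpa using hk), zero_mul]

theorem opMoment_zero_zero (q p y : R) : opMoment q p y 0 0 = 1 := by
  simp [opMoment, opCoeff, mixedMoment]

/-- A case of the `q`-binomial theorem: the Pascal-type rule for `opCoeff` makes the sum telescope,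
and the surviving boundary term cancels the summand `k = 0`. -/
theorem opMoment_zero_succ (q p y : R) (n : ℕ) : opMoment q p y 0 (n + 1) = 0 := by
  have h : ∀ k, opCoeff p y (n + 1) (k + 1) * mixedMoment q p y 0 (k + 1)
      = y * p ^ k * opCoeff p y n k * mixedMoment q p y 0 k
        - y * p ^ (k + 1) * opCoeff p y n (k + 1) * mixedMoment q p y 0 (k + 1) := by
    intro k
    have : (k + 1).choose 2 = k.choose 2 + k := by
      rw [Nat.choose_succ_succ' k 1, Nat.choose_one_right, add_comm]
    simp only [opCoeff, mixedMoment, this]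
    ring
  rw [opMoment, sum_range_succ', sum_congr rfl fun k _ => h k,
    sum_range_sub' (fun k => y * p ^ k * opCoeff p y n k * mixedMoment q p y 0 k),
    opCoeff_eq_zero p y n (n + 1) (Nat.lt_succ_self n)]
  simp [opCoeff, mixedMoment]

theorem pqNumber_zero (p q : R) : pqNumber p q 0 = 0 := by simp [pqNumber]

theorem pqNumber_one (p q : R) : pqNumber p q 1 = 1 := by simp [pqNumber]

/-- Expands `t P_n` in the Newton basis. There is no `N_0` term because the node `t_0` is zero. -/
theorem opMoment_succ (q p y : R) (m : ℕ) {n N : ℕ} (h : n < N) :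
    opMoment q p y (m + 1) n =
      ∑ k ∈ range N, (pqNumber 1 q (k + 1) * opCoeff p y n k
        + pqNumber 1 q (k + 1) * (1 - y * p ^ (k + 1)) * opCoeff p y n (k + 1))
          * mixedMoment q p y m (k + 1) := by
  have hN : opCoeff p y n N = 0 := opCoeff_eq_zero p y n N h
  have e : ∑ k ∈ range N, pqNumber 1 q k * (1 - y * p ^ k) * opCoeff p y n k
        * mixedMoment q p y m k
      = ∑ k ∈ range N, pqNumber 1 q (k + 1) * (1 - y * p ^ (k + 1)) * opCoeff p y n (k + 1)
        * mixedMoment q p y m (k + 1) := by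
    have h1 := sum_range_succ (fun k => pqNumber 1 q k * (1 - y * p ^ k) * opCoeff p y n k
        * mixedMoment q p y m k) N
    rw [sum_range_succ'] at h1
    simpa [hN, pqNumber_zero] using h1.symm
  simp only [add_mul, sum_add_distrib]
  rw [← e, ← sum_add_distrib, opMoment_eq_sum_range q p y (m + 1) h]
  refine sum_congr rfl fun k _ => ?_
  simp only [mixedMoment]
  ring

theorem opMoment_succ_zero (q p y : R) (m : ℕ) :
    opMoment q p y (m + 1) 0 = pqNumber 1 q 1 * opMoment q p y m 1
      + (y * pqNumber 1 q (0 + 1) + pqNumber 1 q 0) * opMoment q p y m 0 := by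
  simp [opMoment, sum_range_succ, opCoeff, mixedMoment, pqNumber_zero, pqNumber_one]

/-! ### The functional as a `y`-adic sum over the nodes -/

/-- `s` is the `y`-adic sum of the series `f`, whose `j`-th tail is divisible by `y ^ j`. -/
def IsAdicSum (y : R) (f : ℕ → R) (s : R) : Prop :=
  ∀ N, y ^ N ∣ s - ∑ j ∈ range N, f j

theorem IsAdicSum.add {y s t : R} {f g : ℕ → R} (hf : IsAdicSum y f s) (hg : IsAdicSum y g t) :
    IsAdicSum y (fun j => f j + g j) (s + t) := fun N => by
  rw [sum_add_distrib, add_sub_add_comm]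
  exact dvd_add (hf N) (hg N)

theorem IsAdicSum.const_mul {y s : R} {f : ℕ → R} (c : R) (hf : IsAdicSum y f s) :
    IsAdicSum y (fun j => c * f j) (c * s) := fun N => by
  rw [← mul_sum, ← mul_sub]
  exact (hf N).mul_left c

/-- The weight of the orthogonality measure at the `j`-th node. -/
def weight (q p y : R) (j : ℕ) : R := y ^ j * p ^ (j * j) * (q ^ j - y * p ^ j)

/-- The `j`-th node of the orthogonality measure. -/
def node (q p y : R) (j : ℕ) : R := pqNumber 1 q j * (1 - y * p ^ j)

/-- The normalized Newton basis at the nodes, evaluated at the `j`-th node. -/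
def newtonBasis (q p y : R) (k j : ℕ) : R :=
  gauss q j k * q ^ (k.choose 2) * ∏ i ∈ range k, (1 - y * p ^ (i + j))

/-- A discrete antiderivative for the weighted Newton basis. -/
def antidiff (q p y : R) (k j : ℕ) : R :=
  y ^ j * p ^ (j * j) * (q ^ j - y * q) * gauss q j (k + 1) * q ^ ((k + 1).choose 2)
    * ∏ i ∈ range k, (1 - y * p ^ (i + j))

/-- Summed over `j`, this yields `L(N_{k+1}) = y p^k L(N_k)`: `antidiff` vanishes at `j = 0` and is
divisible by `y ^ j`, so its differences contribute nothing in the limit. -/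
theorem weight_mul_newtonBasis {q p : R} (hqp : q * p = 1) (y : R) (k j : ℕ) :
    weight q p y j * newtonBasis q p y (k + 1) j
      = y * p ^ k * (weight q p y j * newtonBasis q p y k j)
        + (antidiff q p y k j - antidiff q p y k (j + 1)) := by
  have hj : q ^ j * p ^ j = 1 := by rw [← mul_pow, hqp, one_pow]
  have hk : q ^ k * p ^ k = 1 := by rw [← mul_pow, hqp, one_pow]
  have hg := gauss_step q j k
  have hc : (k + 1).choose 2 = k.choose 2 + k := by
    rw [Nat.choose_succ_succ' k 1, Nat.choose_one_right, add_comm]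
  have hprod : (1 - y * p ^ j) * ∏ i ∈ range k, (1 - y * p ^ (i + (j + 1)))
      = (∏ i ∈ range k, (1 - y * p ^ (i + j))) * (1 - y * p ^ (k + j)) := by
    rw [← prod_range_succ, prod_range_succ', zero_add, mul_comm]
    simp only [add_assoc, add_comm 1 j]
  -- Passing from `j` to `j + 1` releases the factor `1 - y p^j`, exactly the one `hprod` needs to
  -- shift the product.
  have hpow : p ^ ((j + 1) * (j + 1)) * (q ^ (j + 1) - y * q)
      = p ^ (j * j) * p ^ j * (1 - y * p ^ j) := by
    rw [show (j + 1) * (j + 1) = j * j + j + (j + 1) by ring, pow_add,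
      pow_add _ (j * j)]
    linear_combination p ^ (j * j) * p ^ j * (q * p * hj + hqp - y * p ^ j * hqp)
  have hV : antidiff q p y k (j + 1) = y ^ (j + 1) * (p ^ (j * j) * p ^ j)
      * (gauss q j k + q ^ (k + 1) * gauss q j (k + 1)) * q ^ ((k + 1).choose 2)
      * ((∏ i ∈ range k, (1 - y * p ^ (i + j))) * (1 - y * p ^ (k + j))) := by
    rw [← hprod, antidiff, gauss]
    linear_combination y ^ (j + 1) * (gauss q j k + q ^ (k + 1) * gauss q j (k + 1))
      * q ^ ((k + 1).choose 2) * (∏ i ∈ range k, (1 - y * p ^ (i + (j + 1)))) * hpow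
  rw [hV]
  simp only [weight, antidiff, newtonBasis, prod_range_succ, hc]
  set W := ∏ i ∈ range k, (1 - y * p ^ (i + j))
  set c := q ^ (k.choose 2) with hcdef
  rw [pow_add q (k.choose 2) k, ← hcdef]
  have hB : (1 - q ^ (k + 1)) * gauss q j (k + 1) = (1 - q ^ j * p ^ k) * gauss q j k := by
    linear_combination p ^ k * hg
      + (gauss q j k - (1 - q ^ (k + 1)) * gauss q j (k + 1)) * hk
  -- What remains of the claim once the common factors, including the product `W`, are removed.
  have main : (q ^ j - y * p ^ j) * (gauss q j (k + 1) * (1 - y * p ^ (k + j))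
        - y * p ^ k * p ^ k * gauss q j k)
      = (q ^ j - y * q) * gauss q j (k + 1)
        - y * p ^ j * (gauss q j k + q ^ (k + 1) * gauss q j (k + 1)) * (1 - y * p ^ (k + j)) := by
    linear_combination y * (-(p ^ k + p ^ j) * hB
        - p ^ k * (gauss q j (k + 1) - gauss q j k) * hj - q * gauss q j (k + 1) * hk)
      + y ^ 2 * p ^ j * p ^ k * (p ^ j * hB - gauss q j k * p ^ k * hj)
  linear_combination y ^ j * p ^ (j * j) * c * q ^ k * W * main
    + y ^ j * p ^ (j * j) * c * W * (q ^ j - y * p ^ j) * y * p ^ k * gauss q j k * hk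

theorem isAdicSum_weight_mul_newtonBasis {q p : R} (hqp : q * p = 1) (y : R) (k : ℕ) :
    IsAdicSum y (fun j => weight q p y j * newtonBasis q p y k j) (mixedMoment q p y 0 k) := by
  induction k with
  | zero =>
    intro N
    -- The weights telescope: `weight_j` is the difference of `y^j p^(j²) q^j` at `j` and `j + 1`.
    have : ∑ j ∈ range N, weight q p y j * newtonBasis q p y 0 j
        = 1 - y ^ N * p ^ (N * N) * q ^ N := by
      induction N with
      | zero => simp
      | succ N ih =>
        have hN : q ^ N * p ^ N = 1 := by rw [← mul_pow, hqp, one_pow]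
        rw [sum_range_succ, ih, show (N + 1) * (N + 1) = N * N + N + (N + 1) by ring,
          pow_add p, pow_add p (N * N)]
        simp only [weight, newtonBasis, gauss_zero_right, Nat.choose_zero_succ, range_zero,
          prod_empty]
        linear_combination y ^ (N + 1) * p ^ (N * N) * p ^ N * (q * p * hN + hqp)
    rw [this]
    exact ⟨p ^ (N * N) * q ^ N, by simp [mixedMoment]; ring⟩
  | succ k ih =>
    intro N
    have h0 : antidiff q p y k 0 = 0 := by simp [antidiff, gauss]
    have hc : (k + 1).choose 2 = k.choose 2 + k := by
      rw [Nat.choose_succ_succ' k 1, Nat.choose_one_right, add_comm]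
    have hm : mixedMoment q p y 0 (k + 1) = y * p ^ k * mixedMoment q p y 0 k := by
      simp only [mixedMoment, hc]; ring
    rw [sum_congr rfl fun j _ => weight_mul_newtonBasis hqp y k j, sum_add_distrib,
      sum_range_sub', h0, zero_sub, ← sub_sub, sub_neg_eq_add, hm, ← mul_sum, ← mul_sub]
    refine dvd_add ((ih N).mul_left _) ?_
    simp only [antidiff, mul_assoc]
    exact dvd_mul_right _ _

variable [IsDomain R] {q p : R}

/-- The functional applied to `t^m` times the three-term recurrence, compared coefficientwise in the
Newton basis; `opCoeff_recurrence_zero` disposes of the `N_0` coefficient. -/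
theorem opMoment_succ_succ (hqp : q * p = 1) (hq : q ≠ 1) (y : R) (m n : ℕ) :
    opMoment q p y (m + 1) (n + 1) = pqNumber 1 q (n + 2) * opMoment q p y m (n + 2)
      + (y * pqNumber 1 q (n + 1 + 1) + pqNumber 1 q (n + 1)) * opMoment q p y m (n + 1)
      + y * pqNumber 1 q (n + 1) * opMoment q p y m n := by
  rw [opMoment_succ q p y m (show n + 1 < n + 2 by omega),
    opMoment_eq_sum_range q p y m (show n + 2 < n + 3 by omega),
    opMoment_eq_sum_range q p y m (show n + 1 < n + 3 by omega),
    opMoment_eq_sum_range q p y m (show n < n + 3 by omega)]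
  simp only [mul_sum, ← sum_add_distrib]
  rw [sum_range_succ' _ (n + 2)]
  have h0 := opCoeff_recurrence_zero q p y n
  have : ∀ M : R, pqNumber 1 q (n + 2) * (opCoeff p y (n + 2) 0 * M)
      + (y * pqNumber 1 q (n + 1 + 1) + pqNumber 1 q (n + 1)) * (opCoeff p y (n + 1) 0 * M)
      + y * pqNumber 1 q (n + 1) * (opCoeff p y n 0 * M) = 0 := fun M => by
    linear_combination -M * h0
  rw [this, add_zero]
  refine sum_congr rfl fun k _ => ?_
  rw [opCoeff_recurrence hqp hq]
  ring

theorem mk_mixedMoment_eq_F (hqp : q * p = 1) (hq : q ≠ 1) (y : R) :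
    PowerSeries.mk (fun m => mixedMoment q p y m 0) = F q 1 y := by
  have := mk_eq_jFraction (fun n => y * pqNumber 1 q (n + 1) + pqNumber 1 q n)
    (pqNumber 1 q) (fun n => y * pqNumber 1 q n) (opMoment q p y)
    (opMoment_zero_zero q p y) (opMoment_zero_succ q p y) (opMoment_succ_zero q p y)
    (opMoment_succ_succ hqp hq y)
  have h : (fun n => pqNumber 1 q n * (y * pqNumber 1 q n))
      = fun n => y * pqNumber 1 q n ^ 2 := by
    funext n; ring
  rw [h] at this
  rw [F, ← this]
  congr 1
  funext m
  simp [opMoment, opCoeff]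

/-- The Newton recurrence `(t - t_k) N_k = [k+1] N_{k+1}` at `t = t_j`. It rests on the
factorization `t_j - t_k = q^k [j-k] (1 - y p^(k+j))` for `j ≥ k`, with `gauss_step` absorbing
`[j-k]`. -/
theorem node_mul_newtonBasis (hqp : q * p = 1) (hq : q ≠ 1) (y : R) (k j : ℕ) :
    node q p y j * newtonBasis q p y k j
      = pqNumber 1 q (k + 1) * newtonBasis q p y (k + 1) j
        + pqNumber 1 q k * (1 - y * p ^ k) * newtonBasis q p y k j := by
  apply mul_right_cancel₀ (sub_ne_zero.mpr hq.symm)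
  have e1 := pqNumber_one_mul q (k + 1)
  have e2 := pqNumber_one_mul q k
  have e3 := pqNumber_one_mul q j
  have hj : q ^ j * p ^ j = 1 := by rw [← mul_pow, hqp, one_pow]
  have hk : q ^ k * p ^ k = 1 := by rw [← mul_pow, hqp, one_pow]
  have hg := gauss_step q j k
  have hc : (k + 1).choose 2 = k.choose 2 + k := by
    rw [Nat.choose_succ_succ' k 1, Nat.choose_one_right, add_comm]
  simp only [node, newtonBasis, prod_range_succ, hc]
  set W := ∏ i ∈ range k, (1 - y * p ^ (i + j))
  set c := q ^ (k.choose 2) with hcdef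
  rw [pow_add q (k.choose 2) k, ← hcdef]
  linear_combination (1 - y * p ^ j) * (gauss q j k * c * W) * e3
    - (gauss q j (k + 1) * c * q ^ k * W * (1 - y * p ^ (k + j))) * e1
    - (1 - y * p ^ k) * (gauss q j k * c * W) * e2
    - c * W * (1 - y * p ^ (k + j)) * hg
    + c * W * gauss q j k * y * (1 - p ^ k) * hj
    - c * W * gauss q j k * y * (1 - p ^ j) * hk

/-- The recursion defining `mixedMoment` is the Newton recurrence integrated against the weights, so
induction on `m` reduces to the values `L(N_k)`. -/
theorem isAdicSum_mixedMoment (hqp : q * p = 1) (hq : q ≠ 1) (y : R) (m : ℕ) : ∀ k,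
    IsAdicSum y (fun j => weight q p y j * node q p y j ^ m * newtonBasis q p y k j)
      (mixedMoment q p y m k) := by
  induction m with
  | zero => simpa using isAdicSum_weight_mul_newtonBasis hqp y
  | succ m ih =>
    intro k
    convert ((ih (k + 1)).const_mul (pqNumber 1 q (k + 1))).add
      ((ih k).const_mul (pqNumber 1 q k * (1 - y * p ^ k))) using 1
    · funext j
      linear_combination weight q p y j * node q p y j ^ m * node_mul_newtonBasis hqp hq y k j
    · rfl

end Measure

end QEulerian

/-! ### Expansion of the moments in powers of `y` -/

namespace QEulerian

theorem coeff_one_add_C_mul_X_pow {R : Type*} [CommRing R] (a : R) (n i : ℕ) :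
    PowerSeries.coeff i ((1 + PowerSeries.C a * PowerSeries.X : R⟦X⟧) ^ n)
      = n.choose i * a ^ i := by
  have h : (1 + PowerSeries.C a * PowerSeries.X : R⟦X⟧) ^ n
      = PowerSeries.rescale a (((1 + Polynomial.X) ^ n : Polynomial R) : R⟦X⟧) := by
    simp [PowerSeries.rescale_X]
  rw [h, PowerSeries.coeff_rescale, Polynomial.coeff_coe, Polynomial.coeff_one_add_X_pow, mul_comm]

theorem qNumber_eq_pqNumber (n : ℕ) : qNumber n = pqNumber 1 (LaurentPolynomial.T 1) n := by
  simp [qNumber, pqNumber, LaurentPolynomial.T_pow]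

theorem pqNumber_one_C {R : Type*} [CommRing R] (q : R) (n : ℕ) :
    pqNumber 1 (PowerSeries.C q) n = PowerSeries.C (pqNumber 1 q n) := by
  simp [pqNumber]

/-- The contribution of the `j`-th node to a moment, coefficient by coefficient. -/
theorem coeff_weight_mul_node_pow {R : Type*} [CommRing R] (q p : R) (n i j : ℕ) :
    PowerSeries.coeff (i + j) (weight (PowerSeries.C q) (PowerSeries.C p) PowerSeries.X j
        * node (PowerSeries.C q) (PowerSeries.C p) PowerSeries.X j ^ n)
      = (-1) ^ i * pqNumber 1 q j ^ n * p ^ (j * (i + j)) *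
        (n.choose i * q ^ j + if i = 0 then 0 else (n.choose (i - 1) : R)) := by
  have h : weight (PowerSeries.C q) (PowerSeries.C p) PowerSeries.X j
        * node (PowerSeries.C q) (PowerSeries.C p) PowerSeries.X j ^ n
      = (PowerSeries.C (p ^ (j * j) * pqNumber 1 q j ^ n * q ^ j)
          * (1 + PowerSeries.C (-p ^ j) * PowerSeries.X) ^ n
        - PowerSeries.C (p ^ (j * j) * pqNumber 1 q j ^ n * p ^ j)
          * ((1 + PowerSeries.C (-p ^ j) * PowerSeries.X) ^ n * PowerSeries.X))
            * PowerSeries.X ^ j := by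
    have h1 : (1 - PowerSeries.X * PowerSeries.C p ^ j : R⟦X⟧)
        = 1 + PowerSeries.C (-p ^ j) * PowerSeries.X := by
      simp only [map_neg, map_pow]; ring
    rw [weight, node, pqNumber_one_C, h1, mul_pow]
    simp only [map_mul, map_pow]
    ring
  have hp : p ^ (j * (i + j)) = p ^ (j * j) * (p ^ j) ^ i := by
    rw [← pow_mul, ← pow_add]; congr 1; ring
  rw [h, PowerSeries.coeff_mul_X_pow, map_sub, PowerSeries.coeff_C_mul, PowerSeries.coeff_C_mul,
    coeff_one_add_C_mul_X_pow, hp, neg_pow (p ^ j)]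
  rcases i with _ | i
  · simp
    ring
  · rw [PowerSeries.coeff_succ_mul_X, coeff_one_add_C_mul_X_pow, neg_pow (p ^ j)]
    simp only [Nat.succ_ne_zero, if_false, Nat.add_sub_cancel]
    ring

theorem qEulerian_eq_sum (k n : ℕ) (hn : n ≠ 0) :
    qEulerian k n = ∑ j ∈ range (k + 1), PowerSeries.coeff k
      (weight (PowerSeries.C (LaurentPolynomial.T 1)) (PowerSeries.C (LaurentPolynomial.T (-1)))
          PowerSeries.X j
        * node (PowerSeries.C (LaurentPolynomial.T 1)) (PowerSeries.C (LaurentPolynomial.T (-1)))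
          PowerSeries.X j ^ n : ℤ[T;T⁻¹]⟦X⟧) := by
  rw [← sum_range_reflect, sum_range_succ, qEulerian, mul_sum]
  have hlast : k + 1 - 1 - k = 0 := by omega
  -- The node `j = 0` is zero, so its term drops out for `n ≠ 0`; this leaves the range `i < k` of
  -- Williams' sum.
  rw [hlast, node, pqNumber_zero, zero_mul, zero_pow hn, mul_zero, map_zero, add_zero]
  refine sum_congr rfl fun i hi => ?_
  obtain ⟨j, rfl⟩ := Nat.exists_eq_add_of_le (mem_range.mp hi).le
  have e1 : i + j + 1 - 1 - i = j := by omega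
  have e2 : i + j - i = j := by omega
  have e3 : ((i + j : ℕ) : ℤ) - i = j := by push_cast; ring
  rw [e1, e2, e3, coeff_weight_mul_node_pow, qNumber_eq_pqNumber, LaurentPolynomial.T_pow,
    LaurentPolynomial.T_pow, mul_one]
  -- With `k = i + j`, both exponents equal `-jk`.
  have e4 : (LaurentPolynomial.T (((j * (i + j) : ℕ) : ℤ) * -1) : ℤ[T;T⁻¹])
      = LaurentPolynomial.T (((i + j : ℕ) : ℤ) - ((i + j : ℕ) : ℤ) ^ 2)
        * LaurentPolynomial.T (((i + j : ℕ) : ℤ) * ((i : ℤ) - 1)) := by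
    rw [← LaurentPolynomial.T_add]
    congr 1
    push_cast
    ring
  rw [e4]
  ring

end QEulerian

/-- `Ê(q,x,y) = F(q,1,x,y)` in `ℤ[q,q⁻¹]⟦y⟧⟦x⟧`: here `PowerSeries.C (LaurentPolynomial.T 1)` is `q`
and `PowerSeries.X` is `y`. -/
theorem mainTheorem2 :
    QEulerian.qEulerianSeries =
      QEulerian.F (PowerSeries.C (LaurentPolynomial.T 1) : PowerSeries (LaurentPolynomial ℤ))
        1 PowerSeries.X := by
  have hT : (LaurentPolynomial.T 1 : ℤ[T;T⁻¹]) * LaurentPolynomial.T (-1) = 1 := by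
    rw [← LaurentPolynomial.T_add]; simp
  have hqp : (PowerSeries.C (LaurentPolynomial.T 1) : ℤ[T;T⁻¹]⟦X⟧)
      * PowerSeries.C (LaurentPolynomial.T (-1)) = 1 := by
    rw [← map_mul, hT, map_one]
  have hq : (PowerSeries.C (LaurentPolynomial.T 1) : ℤ[T;T⁻¹]⟦X⟧) ≠ 1 := by
    rw [← map_one PowerSeries.C, PowerSeries.C_injective.ne_iff, ← LaurentPolynomial.T_zero]
    intro h
    have := congrArg LaurentPolynomial.degree h
    rw [LaurentPolynomial.degree_T, LaurentPolynomial.degree_T] at this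
    exact absurd this (by decide)
  rw [← QEulerian.mk_mixedMoment_eq_F hqp hq, QEulerian.qEulerianSeries]
  congr 1
  funext n
  split_ifs with hn
  · simp [hn, QEulerian.mixedMoment]
  -- Modulo `y^(k+1)` only the nodes `j ≤ k` count, and the Newton polynomial of index `0` is `1`.
  · ext1 k
    have h := PowerSeries.X_pow_dvd_iff.mp
      (QEulerian.isAdicSum_mixedMoment hqp hq PowerSeries.X n 0 (k + 1)) k (Nat.lt_succ_self k)
    simp only [QEulerian.newtonBasis, QEulerian.gauss_zero_right, Nat.choose_zero_succ, pow_zero,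
      range_zero, prod_empty, mul_one] at h
    rw [map_sub, sub_eq_zero, map_sum] at h
    rw [PowerSeries.coeff_mk, QEulerian.qEulerian_eq_sum k n hn, h]
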